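/- Fix constants $0<\beta\le 1$ and $0<\alpha<\tfrac12$. For each $N$ consider a system of $N$ servers, each with its own first-come-first-served queue of unlimited size. Jobs arrive according to a Poisson process of rate $N\lambda/k$ with load $\lambda=1-\beta N^{-\alpha}$; each job consists of $k$ tasks whose service times are independent and exponential with rate $1$. Tasks are assigned by batch-filling with probe overhead $d>0$ (where $kd$ is an integer): an arriving job samples $kd$ of the $N$ queues uniformly at random without replacement, and its $k$ tasks are put one by one into a currently shortest sampled queue, the queue lengths being updated after each task. Let $S_i$ be the fraction of servers having at least $i$ tasks (including the one in service). Here $k=k(N)$, $d=d(N)$ and the nonnegative integer $h=h(N)$ may depend on $N$, and all asymptotics are for $N\to\infty$. Assume $$k=\omega(1),\qquad k=e^{o(\sqrt{\log N})},\qquad d=e^{o(\log N/\log k)},\qquad h=O(\log k).$$ Then for all sufficiently large $N$ the continuous-time Markov chain $(S_0(t),S_1(t),S_2(t),\dots)$ has a unique stationary distribution, and if $(S_i)_{i\ge 0}$ is distributed according to it, then $$\Pr\Big\{\sum_{i=1}^{h}S_i\ \ge\ h-\frac{1}{3d}\Big\}\ \ge\ \frac{1}{4e^2}.$$ -/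

import Mathlib

open Filter Asymptotics Topology

namespace BatchFilling

noncomputable section

/-- A state of the system with `N` queues (unlimited buffers): the multiset of the `N` queue
lengths, a queue length counting the task in service.  The multiplicity of `i` in the state is
`N * (S_i - S_{i+1})`, so a state carries the same information as the sequence
`(S_0, S_1, S_2, ...)` of the fractions of servers with at least `i` tasks. -/
abbrev State (N : ℕ) : Type := Sym ℕ N

/-- `frac s i` is `S_i`: the fraction of the servers that have at least `i` tasks. -/
def frac {N : ℕ} (s : State N) (i : ℕ) : ℝ :=
  ((s : Multiset ℕ).countP (fun x => i ≤ x) : ℝ) / N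

/-- One round of batch-filling on a multiset `a` of sampled queue lengths: one task is put into a
shortest sampled queue, whose length goes up by one (nothing happens if there is no queue). -/
def assignOne (a : Multiset ℕ) : Multiset ℕ :=
  if a = 0 then 0 else (sInf {x | x ∈ a} + 1) ::ₘ a.erase (sInf {x | x ∈ a})

/-- Batch-filling of the `k` tasks of a job: `k` rounds, with the queue lengths updated after
each of them. -/
def fill (k : ℕ) (a : Multiset ℕ) : Multiset ℕ := assignOne^[k] a

/-- Rate of the transitions from `s` to `s'` that are caused by a job arrival.  Jobs of `k` tasks
arrive at rate `N * lam / k`; a job samples `m` of the `N` queues uniformly at random without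
replacement.  (`Multiset.powersetCard m s` lists, with multiplicity, the queue lengths in each of
the `N.choose m` possible samples.) -/
def arrivalRate {N : ℕ} (lam : ℝ) (k m : ℕ) (s s' : State N) : ℝ :=
  (N * lam / k) *
    (((Multiset.powersetCard m (s : Multiset ℕ)).countP
      (fun a => (s : Multiset ℕ) - a + fill k a = (s' : Multiset ℕ)) : ℝ) / (N.choose m : ℝ))

/-- Rate of the transitions from `s` to `s'` that are caused by a task completion: every nonempty
queue completes tasks at rate `1`, and then its length goes down by one. -/
def departureRate {N : ℕ} (s s' : State N) : ℝ :=
  ((s : Multiset ℕ).countP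
    (fun x => 0 < x ∧ (x - 1) ::ₘ (s : Multiset ℕ).erase x = (s' : Multiset ℕ)) : ℝ)

/-- Transition rates of the continuous-time Markov chain of the system with `N` servers, load
`lam`, `k` tasks per job and `m` probes per job, under batch-filling. -/
def rate {N : ℕ} (lam : ℝ) (k m : ℕ) (s s' : State N) : ℝ :=
  arrivalRate lam k m s s' + departureRate s s'

/-- `π` is a stationary distribution of the chain: at every state the probability flow in equals
the probability flow out.  The total rate out of a state is at most `N * lam / k + N`, so these
global balance equations characterize invariance under the transition semigroup. -/
def IsStationary {N : ℕ} (lam : ℝ) (k m : ℕ) (π : PMF (State N)) : Prop :=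
  ∀ s' : State N,
    ∑' s : State N, π s * ENNReal.ofReal (rate lam k m s s') =
      π s' * ∑' s : State N, ENNReal.ofReal (rate lam k m s' s)

end

end BatchFilling

/-! Under any stationary distribution the generator of a bounded test function has mean zero. Three
observations suffice.

Work conservation: tasks arrive at rate `N * lam` and leave at a rate equal to the number of busy
servers, so the mean number of busy servers is at least `N * lam` and that of idle ones at most `N *
(1 - lam)` (`tsum_short_one_le`).

Recursion: take as test function the number of queues shorter than `i`. It gains one for each
completion at a queue of length exactly `i`. Jobs remove at most the short queues they sample, at
mean rate at most `lam * d` times the number of short queues. Hence passing from `i` to `i + 1`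
multiplies the mean by at most `1 + lam * d` (`tsum_short_succ_le`).

Markov: `h` minus the sum of the `S_i` is the normalized sum of these numbers, with mean at most `(1
- lam) * (1 + d) ^ h / d`. It exceeds `1 / (3 * d)` with probability at most `3 * (1 - lam) * (1 +
d) ^ h`. The growth conditions give `(1 + d) ^ h ≤ N ^ (α / 2)`, so this is at most `3 * N ^ (-α /
2)` and tends to zero.

These bounds use only that all `k` tasks go to sampled queues. The shortest-queue rule enters
through stability: it gives the sum of squared lengths a negative drift, hence existence. Uniqueness
holds because the empty state is reachable from everywhere. -/

namespace MarkovRate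

/-! ### Uniformization of bounded rates, and uniqueness of the invariant distribution. -/

open scoped ENNReal

/-- One step of the transition matrix `P`, acting on weight functions from the right. -/
noncomputable def step {X : Type*} (P : X → X → ℝ≥0∞) (μ : X → ℝ≥0∞) (y : X) : ℝ≥0∞ :=
  ∑' x, μ x * P x y

/-- The balance equations of the transition rates `q`. -/
def Balanced {X : Type*} (q : X → X → ℝ≥0∞) (π : X → ℝ≥0∞) : Prop :=
  ∀ y, ∑' x, π x * q x y = π y * ∑' z, q y z

/-- The transition matrix of the uniformization, with rate `L`, of the rates `q`. -/
noncomputable def uniformize {X : Type*} (q : X → X → ℝ≥0∞) (L : ℝ≥0∞) (x y : X) : ℝ≥0∞ :=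
  open Classical in (q x y + if x = y then L - ∑' z, q x z else 0) / L

theorem eq_of_le_of_tsum_le {X : Type*} {f g : X → ℝ≥0∞} (hle : ∀ x, f x ≤ g x)
    (hg : ∑' x, g x ≤ ∑' x, f x) (hf : ∑' x, f x ≠ ∞) : f = g := by
  have h1 : ∑' x, (g x - f x) = 0 := by
    have h2 : ∑' x, (g x - f x) + ∑' x, f x ≤ 0 + ∑' x, f x := by
      rw [← ENNReal.tsum_add, zero_add]
      simpa only [tsub_add_cancel_of_le (hle _)] using hg
    exact le_antisymm ((ENNReal.add_le_add_iff_right hf).1 h2) bot_le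
  rw [ENNReal.tsum_eq_zero] at h1
  funext x
  exact le_antisymm (hle x) (tsub_eq_zero_iff_le.1 (h1 x))

theorem tsum_step_mul {X : Type*} (P : X → X → ℝ≥0∞) (μ V : X → ℝ≥0∞) :
    ∑' y, step P μ y * V y = ∑' x, μ x * ∑' y, P x y * V y := by
  simp only [step, ← ENNReal.tsum_mul_right, ← ENNReal.tsum_mul_left]
  rw [ENNReal.tsum_comm]
  simp only [mul_assoc]

theorem tsum_step {X : Type*} {P : X → X → ℝ≥0∞} (hP : ∀ x, ∑' y, P x y = 1) (μ : X → ℝ≥0∞) :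
    ∑' y, step P μ y = ∑' x, μ x := by
  simpa [hP] using tsum_step_mul P μ 1

theorem tsum_uniformize_mul {X : Type*} (q : X → X → ℝ≥0∞) (L : ℝ≥0∞) (V : X → ℝ≥0∞) (x : X) :
    ∑' y, uniformize q L x y * V y =
      (∑' y, q x y * V y + (L - ∑' z, q x z) * V x) / L := by
  classical
  simp only [uniformize, div_eq_mul_inv]
  have : ∀ y, (q x y + if x = y then L - ∑' z, q x z else 0) * L⁻¹ * V y =
      (q x y * V y + if x = y then (L - ∑' z, q x z) * V y else 0) * L⁻¹ := by
    intro y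
    split_ifs <;> ring
  simp only [this]
  rw [ENNReal.tsum_mul_right, ENNReal.tsum_add]
  congr 2
  rw [tsum_eq_single x]
  · simp
  · intro y hy
    simp [hy.symm]

theorem tsum_uniformize {X : Type*} {q : X → X → ℝ≥0∞} {L : ℝ≥0∞} (hL0 : L ≠ 0) (hL : L ≠ ∞)
    (hq : ∀ x, ∑' y, q x y ≤ L) (x : X) : ∑' y, uniformize q L x y = 1 := by
  have h := tsum_uniformize_mul q L 1 x
  simp only [Pi.one_apply, mul_one] at h
  rw [h, add_tsub_cancel_of_le (hq x), ENNReal.div_self hL0 hL]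

theorem step_uniformize {X : Type*} (q : X → X → ℝ≥0∞) (L : ℝ≥0∞) (μ : X → ℝ≥0∞) (y : X) :
    step (uniformize q L) μ y = (∑' x, μ x * q x y + μ y * (L - ∑' z, q y z)) / L := by
  classical
  simp only [uniformize, step, div_eq_mul_inv]
  have : ∀ x, μ x * ((q x y + if x = y then L - ∑' z, q x z else 0) * L⁻¹) =
      (μ x * q x y + if x = y then μ x * (L - ∑' z, q x z) else 0) * L⁻¹ := by
    intro x
    split_ifs <;> ring
  simp only [this]
  rw [ENNReal.tsum_mul_right, ENNReal.tsum_add]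
  congr 2
  rw [tsum_eq_single y]
  · simp
  · intro x hx
    simp [hx]

/-- Both equations differ by the holding term `π y * (L - ∑' z, q y z)`, which cancels because it is
finite. -/
theorem balanced_iff_step_eq {X : Type*} {q : X → X → ℝ≥0∞} {L : ℝ≥0∞} (hL0 : L ≠ 0) (hL : L ≠ ∞)
    (hq : ∀ x, ∑' y, q x y ≤ L) {π : X → ℝ≥0∞} (hπ : ∀ x, π x ≠ ∞) :
    Balanced q π ↔ step (uniformize q L) π = π := by
  rw [funext_iff]
  refine forall_congr' fun y => ?_
  rw [step_uniformize, eq_comm (b := π y), ENNReal.eq_div_iff hL0 hL, eq_comm (a := L * π y)]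
  have h2 : L * π y = π y * ∑' z, q y z + π y * (L - ∑' z, q y z) := by
    rw [← mul_add, add_tsub_cancel_of_le (hq y), mul_comm]
  rw [h2]
  have h3 : π y * (L - ∑' z, q y z) ≠ ∞ :=
    ENNReal.mul_ne_top (hπ y) (ne_top_of_le_ne_top hL tsub_le_self)
  exact (ENNReal.add_left_inj h3).symm

/-- The positive part of the difference of two invariant weights is invariant. -/
theorem step_sub_eq {X : Type*} {P : X → X → ℝ≥0∞} (hP : ∀ x, ∑' y, P x y = 1)
    {π ρ : X → ℝ≥0∞} (hπ : step P π = π) (hρ : step P ρ = ρ) (hπ1 : ∑' x, π x ≠ ∞) :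
    step P (fun x => π x - ρ x) = fun x => π x - ρ x := by
  symm
  -- From `π ≤ ρ + (π - ρ)` the truncated difference is at most its own image; a step preserves the
  -- finite mass, so equality holds.
  apply eq_of_le_of_tsum_le
  · intro y
    rw [tsub_le_iff_left]
    calc π y = ∑' x, π x * P x y := (congrFun hπ y).symm
      _ ≤ ∑' x, (ρ x * P x y + (π x - ρ x) * P x y) := by
        refine ENNReal.tsum_le_tsum fun x => ?_
        rw [← add_mul]
        gcongr
        exact le_add_tsub
      _ = ρ y + step P (fun x => π x - ρ x) y := by
        rw [ENNReal.tsum_add]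
        congr 1
        exact congrFun hρ y
  · exact (tsum_step hP _).le
  · exact ne_top_of_le_ne_top hπ1 (ENNReal.tsum_le_tsum fun x => tsub_le_self)

theorem pos_of_reachable {X : Type*} {P : X → X → ℝ≥0∞} {μ : X → ℝ≥0∞} (hμ : step P μ = μ)
    {x y : X} (h : Relation.ReflTransGen (fun x y => P x y ≠ 0) x y) (hx : μ x ≠ 0) :
    μ y ≠ 0 := by
  induction h with
  | refl => exact hx
  | @tail b c _ hbc ih =>
    intro h0
    rw [← hμ, step, ENNReal.tsum_eq_zero] at h0
    exact mul_ne_zero ih hbc (h0 b)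

/-- If `ρ x₀ ≤ π x₀`, the positive part of `ρ - π` is invariant and zero at `x₀`. Positivity
anywhere would propagate to `x₀`, so `ρ ≤ π`, and equal masses give equality. -/
theorem invariant_unique {X : Type*} {P : X → X → ℝ≥0∞} (hP : ∀ x, ∑' y, P x y = 1) (x₀ : X)
    (hreach : ∀ x, Relation.ReflTransGen (fun x y => P x y ≠ 0) x x₀) {π ρ : PMF X}
    (hπ : step P π = π) (hρ : step P ρ = ρ) : π = ρ := by
  have key : ∀ {π ρ : PMF X}, step P π = π → step P ρ = ρ → ρ x₀ ≤ π x₀ → ρ = π := by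
    intro π ρ hπ hρ h
    have h1 := step_sub_eq hP hρ hπ (by simp [ρ.tsum_coe])
    have h2 : ∀ x, ρ x ≤ π x := by
      intro x
      by_contra hx
      exact pos_of_reachable h1 (hreach x) (fun h0 => hx (tsub_eq_zero_iff_le.1 h0))
        (tsub_eq_zero_of_le h)
    exact DFunLike.coe_injective
      (eq_of_le_of_tsum_le h2 (by simp [PMF.tsum_coe]) (by simp [PMF.tsum_coe]))
  rcases le_total (ρ x₀) (π x₀) with h | h
  · exact (key hπ hρ h).symm
  · exact key hρ hπ h

theorem balanced_unique {X : Type*} {q : X → X → ℝ≥0∞} {L : ℝ≥0∞} (hL0 : L ≠ 0) (hL : L ≠ ∞)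
    (hq : ∀ x, ∑' y, q x y ≤ L) (x₀ : X)
    (hreach : ∀ x, Relation.ReflTransGen (fun x y => q x y ≠ 0) x x₀) {π ρ : PMF X}
    (hπ : Balanced q π) (hρ : Balanced q ρ) : π = ρ := by
  refine invariant_unique (tsum_uniformize hL0 hL hq) x₀ (fun x => ?_)
    ((balanced_iff_step_eq hL0 hL hq π.apply_ne_top).1 hπ)
    ((balanced_iff_step_eq hL0 hL hq ρ.apply_ne_top).1 hρ)
  refine Relation.ReflTransGen.mono (fun a b hab => ?_) _ _ (hreach x)
  simp only [uniformize, ne_eq, ENNReal.div_eq_zero_iff, add_eq_zero, not_or]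
  exact ⟨fun h => hab h.1, hL⟩

/-! ### Existence of an invariant distribution by a Foster-Lyapunov argument. -/

/-- A countable chain with a Foster-Lyapunov function, all of whose states have finitely many
predecessors, has an invariant distribution. -/
theorem exists_invariant {X : Type*} {P : X → X → ℝ≥0∞} (hP : ∀ x, ∑' y, P x y = 1)
    (hfin : ∀ y, {x | P x y ≠ 0}.Finite) (V W : X → ℝ≥0∞) (C : ℝ≥0∞) (hC : C ≠ ∞) (x₀ : X)
    (hV : V x₀ ≠ ∞) (hP_top : ∀ x y, P x y ≠ ∞)
    (hW : ∀ n : ℕ, {x | W x ≤ n}.Finite)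
    (hdrift : ∀ x, ∑' y, P x y * V y + W x ≤ V x + C) :
    ∃ π : PMF X, step P π = π := by
  classical
  let μ : ℕ → X → ℝ≥0∞ := fun n => (step P)^[n] (fun x => if x = x₀ then 1 else 0)
  have hμs : ∀ n, μ (n + 1) = step P (μ n) := fun n => Function.iterate_succ_apply' _ _ _
  have hμ1 : ∀ n, ∑' x, μ n x = 1 := by
    intro n
    induction n with
    | zero => simp [μ]
    | succ n ih => rw [hμs, tsum_step hP, ih]
  have hμle : ∀ n x, μ n x ≤ 1 := fun n x => (ENNReal.le_tsum x).trans (hμ1 n).le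
  -- The drift condition summed over time: the cumulative mean of `W` grows at most linearly.
  have hdr : ∀ n, ∑' x, μ n x * V x + ∑ j ∈ Finset.range n, ∑' x, μ j x * W x ≤ V x₀ + n * C := by
    intro n
    induction n with
    | zero => simp [μ]
    | succ n ih =>
      have h1 : ∑' x, μ (n + 1) x * V x + ∑' x, μ n x * W x ≤ ∑' x, μ n x * V x + C := by
        rw [hμs, tsum_step_mul, ← ENNReal.tsum_add]
        calc _ ≤ ∑' x, (μ n x * V x + μ n x * C) := by
              refine ENNReal.tsum_le_tsum fun x => ?_
              rw [← mul_add, ← mul_add]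
              exact mul_le_mul_right (hdrift x) _
          _ = _ := by rw [ENNReal.tsum_add, ENNReal.tsum_mul_right, hμ1, one_mul]
      rw [Finset.sum_range_succ]
      calc _ = (∑' x, μ (n + 1) x * V x + ∑' x, μ n x * W x) +
            ∑ j ∈ Finset.range n, ∑' x, μ j x * W x := by ring
        _ ≤ (∑' x, μ n x * V x + C) + ∑ j ∈ Finset.range n, ∑' x, μ j x * W x := by gcongr
        _ = (∑' x, μ n x * V x + ∑ j ∈ Finset.range n, ∑' x, μ j x * W x) + C := by ring
        _ ≤ (V x₀ + n * C) + C := by gcongr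
        _ = _ := by push_cast; ring
  -- Cesàro averages of the laws started at `x₀`; their limit points are the candidates.
  let A : ℕ → X → ℝ≥0∞ := fun n x => (∑ j ∈ Finset.range (n + 1), μ j x) / ((n + 1 : ℕ) : ℝ≥0∞)
  have hn0 : ∀ n : ℕ, ((n + 1 : ℕ) : ℝ≥0∞) ≠ 0 := fun n => by simp
  have hnt : ∀ n : ℕ, ((n + 1 : ℕ) : ℝ≥0∞) ≠ ∞ := fun n => ENNReal.natCast_ne_top _
  have hAsum : ∀ (f : X → ℝ≥0∞) n, ∑' x, A n x * f x =
      (∑ j ∈ Finset.range (n + 1), ∑' x, μ j x * f x) / ((n + 1 : ℕ) : ℝ≥0∞) := by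
    intro f n
    simp only [A, div_eq_mul_inv]
    rw [← Summable.tsum_finsetSum (fun _ _ => ENNReal.summable), ← ENNReal.tsum_mul_right]
    refine tsum_congr fun x => ?_
    rw [← Finset.sum_mul]
    ring
  have hA1 : ∀ n, ∑' x, A n x = 1 := by
    intro n
    have := hAsum 1 n
    simp only [Pi.one_apply, mul_one, hμ1, Finset.sum_const, Finset.card_range,
      nsmul_eq_mul] at this
    rw [this, ENNReal.div_self (hn0 n) (hnt n)]
  have hAW : ∀ n, ∑' x, A n x * W x ≤ V x₀ + C := by
    intro n
    rw [hAsum]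
    refine ENNReal.div_le_of_le_mul ?_
    refine (le_add_self.trans (hdr (n + 1))).trans ?_
    rw [add_mul, mul_comm C]
    gcongr
    exact le_mul_of_one_le_right' (by exact_mod_cast Nat.le_add_left 1 n)
  -- By telescoping, an average is invariant up to two boundary terms of size at most `1 / (n + 1)`.
  have hAstep : ∀ n y, step P (A n) y + μ 0 y / ((n + 1 : ℕ) : ℝ≥0∞) =
      A n y + μ (n + 1) y / ((n + 1 : ℕ) : ℝ≥0∞) := by
    intro n y
    have h1 : step P (A n) y =
        (∑ j ∈ Finset.range (n + 1), μ (j + 1) y) / ((n + 1 : ℕ) : ℝ≥0∞) := by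
      rw [step, hAsum (fun x => P x y)]
      simp only [hμs]
      rfl
    rw [h1, ← ENNReal.add_div, ← ENNReal.add_div, ← Finset.sum_range_succ' (fun j => μ j y),
      Finset.sum_range_succ]
  -- The product of copies of `[0, ∞]` is compact, so a free ultrafilter gives a pointwise limit
  -- without choosing subsequences.
  obtain ⟨π, -, hπ⟩ := isCompact_univ.ultrafilter_le_nhds ((hyperfilter ℕ).map A)
    (by simp)
  have hlim : ∀ x, Tendsto (fun n => A n x) (hyperfilter ℕ : Filter ℕ) (𝓝 (π x)) := by
    have : Tendsto A (hyperfilter ℕ : Filter ℕ) (𝓝 π) := hπ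
    exact tendsto_pi_nhds.1 this
  have hsmall : ∀ m : ℕ → ℕ, ∀ y, Tendsto (fun n => μ (m n) y / ((n + 1 : ℕ) : ℝ≥0∞))
      (hyperfilter ℕ : Filter ℕ) (𝓝 0) := by
    intro m y
    refine Tendsto.mono_left ?_ (hyperfilter_le_cofinite.trans Nat.cofinite_eq_atTop.le)
    have h0 : Tendsto (fun n : ℕ => (((n + 1 : ℕ) : ℝ≥0∞))⁻¹) atTop (𝓝 0) :=
      ENNReal.tendsto_inv_nat_nhds_zero.comp (tendsto_add_atTop_nat 1)
    refine tendsto_of_tendsto_of_tendsto_of_le_of_le tendsto_const_nhds h0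
      (fun n => bot_le) (fun n => ?_)
    rw [div_eq_mul_inv]
    exact mul_le_of_le_one_left' (hμle _ y)
  have hπle : ∑' x, π x ≤ 1 := by
    refine ENNReal.summable.tsum_le_of_sum_le fun F => ?_
    refine le_of_tendsto (tendsto_finsetSum F fun x _ => hlim x) (Eventually.of_forall fun n => ?_)
    exact (ENNReal.sum_le_tsum F).trans (hA1 n).le
  have hπfin : ∀ x, π x ≠ ∞ := fun x =>
    ne_top_of_le_ne_top ENNReal.one_ne_top ((ENNReal.le_tsum x).trans hπle)
  -- Markov's inequality for `W`, whose sublevel sets are finite. Dividing by `c → ∞` shows that no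
  -- mass escapes in the limit.
  have htight : ∀ c : ℕ, (c : ℝ≥0∞) ≤ c * ∑' x, π x + (V x₀ + C) := by
    intro c
    have h1 : ∀ n, (c : ℝ≥0∞) ≤ c * ∑ x ∈ (hW c).toFinset, A n x + (V x₀ + C) := by
      intro n
      calc (c : ℝ≥0∞) = ∑' x, c * A n x := by rw [ENNReal.tsum_mul_left, hA1, mul_one]
        _ ≤ ∑' x, (c * (if x ∈ (hW c).toFinset then A n x else 0) + A n x * W x) := by
          refine ENNReal.tsum_le_tsum fun x => ?_
          split_ifs with hx
          · exact le_self_add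
          · simp only [Set.Finite.mem_toFinset, Set.mem_ofPred_eq, not_le] at hx
            rw [mul_zero, zero_add, mul_comm]
            gcongr
        _ = c * ∑ x ∈ (hW c).toFinset, A n x + ∑' x, A n x * W x := by
          rw [ENNReal.tsum_add, ENNReal.tsum_mul_left]
          congr 2
          rw [tsum_eq_sum (s := (hW c).toFinset) (fun x hx => if_neg hx)]
          exact Finset.sum_congr rfl fun x hx => if_pos hx
        _ ≤ _ := by gcongr; exact hAW n
    have h2 : Tendsto (fun n => c * ∑ x ∈ (hW c).toFinset, A n x + (V x₀ + C))
        (hyperfilter ℕ : Filter ℕ) (𝓝 (c * ∑ x ∈ (hW c).toFinset, π x + (V x₀ + C))) := by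
      refine Tendsto.add_const _ (ENNReal.Tendsto.const_mul
        (tendsto_finsetSum _ fun x _ => hlim x) (Or.inr (ENNReal.natCast_ne_top c)))
    refine (ge_of_tendsto h2 (Eventually.of_forall h1)).trans ?_
    gcongr
    exact ENNReal.sum_le_tsum _
  have hπge : 1 ≤ ∑' x, π x := by
    have h0 : Tendsto (fun c : ℕ => ∑' x, π x + (V x₀ + C) * (c : ℝ≥0∞)⁻¹) atTop
        (𝓝 (∑' x, π x + (V x₀ + C) * 0)) :=
      tendsto_const_nhds.add (ENNReal.Tendsto.const_mul ENNReal.tendsto_inv_nat_nhds_zero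
        (Or.inr (ENNReal.add_ne_top.2 ⟨hV, hC⟩)))
    rw [mul_zero, add_zero] at h0
    refine ge_of_tendsto h0 ?_
    filter_upwards [eventually_ge_atTop 1] with c hc
    have hc0 : (c : ℝ≥0∞) ≠ 0 := by exact_mod_cast (by omega : c ≠ 0)
    have h1 := htight c
    calc (1 : ℝ≥0∞) = c * (c : ℝ≥0∞)⁻¹ :=
          (ENNReal.mul_inv_cancel hc0 (ENNReal.natCast_ne_top c)).symm
      _ ≤ (c * ∑' x, π x + (V x₀ + C)) * (c : ℝ≥0∞)⁻¹ := by gcongr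
      _ = (c * (c : ℝ≥0∞)⁻¹) * ∑' x, π x + (V x₀ + C) * (c : ℝ≥0∞)⁻¹ := by ring
      _ = _ := by rw [ENNReal.mul_inv_cancel hc0 (ENNReal.natCast_ne_top c), one_mul]
  -- Finitely many predecessors make a step a finite sum, so it commutes with the pointwise limit.
  have hstep_sum : ∀ (ν : X → ℝ≥0∞) y, step P ν y = ∑ x ∈ (hfin y).toFinset, ν x * P x y := by
    intro ν y
    refine tsum_eq_sum fun x hx => ?_
    have : P x y = 0 := by simpa using hx
    rw [this, mul_zero]
  refine ⟨⟨π, (le_antisymm hπle hπge) ▸ ENNReal.summable.hasSum⟩, ?_⟩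
  funext y
  change step P π y = π y
  have h1 : Tendsto (fun n => step P (A n) y + μ 0 y / ((n + 1 : ℕ) : ℝ≥0∞))
      (hyperfilter ℕ : Filter ℕ) (𝓝 (step P π y + 0)) := by
    refine Tendsto.add ?_ (hsmall (fun _ => 0) y)
    simp only [hstep_sum]
    exact tendsto_finsetSum _ fun x _ =>
      ENNReal.Tendsto.mul_const (hlim x) (Or.inr (hP_top x y))
  have h2 : Tendsto (fun n => A n y + μ (n + 1) y / ((n + 1 : ℕ) : ℝ≥0∞))
      (hyperfilter ℕ : Filter ℕ) (𝓝 (π y + 0)) := (hlim y).add (hsmall (fun n => n + 1) y)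
  simp only [hAstep] at h1
  simpa using tendsto_nhds_unique h1 h2

theorem exists_balanced {X : Type*} {q : X → X → ℝ≥0∞} {L : ℝ≥0∞} (hL0 : L ≠ 0) (hL : L ≠ ∞)
    (hq : ∀ x, ∑' y, q x y ≤ L) (hfin : ∀ y, {x | q x y ≠ 0}.Finite) (V W : X → ℝ≥0∞) (C : ℝ≥0∞)
    (hC : C ≠ ∞) (x₀ : X) (hV : V x₀ ≠ ∞) (hW : ∀ n : ℕ, {x | W x ≤ n}.Finite)
    (hdrift : ∀ x, ∑' y, q x y * V y + W x ≤ (∑' y, q x y) * V x + C) :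
    ∃ π : PMF X, Balanced q π := by
  classical
  have hP := tsum_uniformize hL0 hL hq
  have hpred : ∀ y, {x | uniformize q L x y ≠ 0}.Finite := by
    refine fun y => ((hfin y).union (Set.finite_singleton y)).subset fun x hx => ?_
    by_cases hxy : x = y
    · exact Or.inr hxy
    · refine Or.inl fun h0 => hx ?_
      simp [uniformize, hxy, h0]
  have hWL : ∀ n : ℕ, {x | W x / L ≤ n}.Finite := by
    intro n
    obtain ⟨l, hl⟩ := ENNReal.exists_nat_gt hL
    refine (hW (n * l)).subset fun x hx => ?_
    simp only [Set.mem_ofPred_eq] at hx ⊢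
    rw [ENNReal.div_le_iff hL0 hL] at hx
    push_cast
    exact hx.trans (by gcongr)
  have hdriftL : ∀ x, ∑' y, uniformize q L x y * V y + W x / L ≤ V x + C / L := by
    intro x
    rw [tsum_uniformize_mul, ← ENNReal.add_div]
    refine ENNReal.div_le_of_le_mul ?_
    rw [add_mul, ENNReal.div_mul_cancel hL0 hL]
    calc _ = (∑' y, q x y * V y + W x) + (L - ∑' z, q x z) * V x := by ring
      _ ≤ ((∑' y, q x y) * V x + C) + (L - ∑' z, q x z) * V x :=
        add_le_add_left (hdrift x) _
      _ = (∑' y, q x y + (L - ∑' z, q x z)) * V x + C := by ring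
      _ = _ := by rw [add_tsub_cancel_of_le (hq x), mul_comm]
  obtain ⟨π, hπ⟩ := exists_invariant hP hpred V (fun x => W x / L) (C / L)
    (ENNReal.div_ne_top hC hL0) x₀ hV
    (fun x y => ne_top_of_le_ne_top ENNReal.one_ne_top ((ENNReal.le_tsum y).trans (hP x).le))
    hWL hdriftL
  exact ⟨π, (balanced_iff_step_eq hL0 hL hq π.apply_ne_top).2 hπ⟩

/-- In a stationary distribution the mean of the generator applied to any test function is zero. -/
theorem Balanced.tsum_mul_eq {X : Type*} {q : X → X → ℝ≥0∞} {π : X → ℝ≥0∞} (h : Balanced q π)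
    (f : X → ℝ≥0∞) :
    ∑' x, π x * ∑' y, q x y * f y = ∑' x, π x * ((∑' y, q x y) * f x) := by
  rw [← tsum_step_mul]
  refine tsum_congr fun y => ?_
  rw [← mul_assoc, ← h y, step]

end MarkovRate

/-! ### Batch-filling and sampling as identities and inequalities in natural numbers. -/

namespace BatchFilling

theorem sum_map_filter_eq {p : ℕ → Prop} [DecidablePred p] {φ : ℕ → ℕ} (h : ∀ x, ¬ p x → φ x = 0)
    (t : Multiset ℕ) : ((t.filter p).map φ).sum = (t.map φ).sum := by
  induction t using Multiset.induction_on with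
  | empty => simp
  | cons a t ih =>
    by_cases ha : p a
    · simp [ha, ih]
    · simp [ha, ih, h a ha]

theorem assignOne_eq {a : Multiset ℕ} (ha : a ≠ 0) :
    ∃ x t, a = x ::ₘ t ∧ assignOne a = (x + 1) ::ₘ t ∧ ∀ y ∈ a, x ≤ y := by
  have hne : {x | x ∈ a}.Nonempty := Multiset.exists_mem_of_ne_zero ha
  refine ⟨sInf {x | x ∈ a}, a.erase (sInf {x | x ∈ a}),
    (Multiset.cons_erase (Nat.sInf_mem hne)).symm, by rw [assignOne, if_neg ha],
    fun y hy => Nat.sInf_le hy⟩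

theorem card_assignOne (a : Multiset ℕ) : (assignOne a).card = a.card := by
  by_cases ha : a = 0
  · simp [assignOne, ha]
  · obtain ⟨x, t, h1, h2, -⟩ := assignOne_eq ha
    rw [h2, h1]
    simp

theorem fill_succ (k : ℕ) (a : Multiset ℕ) : fill (k + 1) a = assignOne (fill k a) :=
  Function.iterate_succ_apply' _ _ _

theorem card_fill (k : ℕ) (a : Multiset ℕ) : (fill k a).card = a.card := by
  induction k with
  | zero => rfl
  | succ k ih => rw [fill_succ, card_assignOne, ih]

theorem sum_fill (k : ℕ) {a : Multiset ℕ} (ha : 0 < a.card) : (fill k a).sum = a.sum + k := by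
  induction k with
  | zero => rfl
  | succ k ih =>
    obtain ⟨x, t, h1, h2, -⟩ := assignOne_eq (a := fill k a)
      (by rw [← Multiset.card_pos, card_fill]; exact ha)
    rw [fill_succ, h2, ← add_assoc, ← ih, h1]
    simp only [Multiset.sum_cons]
    omega

/-- The receiving queue, being shortest, is at most the sample mean, and raising `x` by one adds `2
* x + 1` to the squares. -/
theorem sum_sq_assignOne_le (a : Multiset ℕ) :
    a.card * ((assignOne a).map (· ^ 2)).sum ≤
      a.card * ((a.map (· ^ 2)).sum + 1) + 2 * a.sum := by
  by_cases ha : a = 0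
  · simp [assignOne, ha]
  · obtain ⟨x, t, h1, h2, h3⟩ := assignOne_eq ha
    have h4 : a.card * x ≤ a.sum := by simpa using Multiset.card_nsmul_le_sum h3
    have h5 : ((assignOne a).map (· ^ 2)).sum = (a.map (· ^ 2)).sum + 2 * x + 1 := by
      rw [h2, h1]
      simp only [Multiset.map_cons, Multiset.sum_cons]
      ring
    rw [h5]
    nlinarith

theorem sum_sq_fill_le (k : ℕ) {a : Multiset ℕ} (ha : 0 < a.card) :
    a.card * ((fill k a).map (· ^ 2)).sum ≤
      a.card * (a.map (· ^ 2)).sum + 2 * k * a.sum + a.card * (2 * k ^ 2 + k) := by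
  induction k with
  | zero => simp [fill]
  | succ k ih =>
    have h1 := sum_sq_assignOne_le (fill k a)
    rw [card_fill, sum_fill k ha, ← fill_succ] at h1
    nlinarith

/-- Every queue lies in the same number of samples. -/
theorem sum_powersetCard_succ (φ : ℕ → ℕ) (t : Multiset ℕ) (m : ℕ) :
    ((Multiset.powersetCard (m + 1) t).map fun a => (a.map φ).sum).sum =
      (t.card - 1).choose m * (t.map φ).sum := by
  induction t using Multiset.induction_on generalizing m with
  | empty => simp [Multiset.powersetCard_zero_right]
  | cons x t ih =>
    rw [Multiset.powersetCard_cons, Multiset.map_add, Multiset.sum_add, ih, Multiset.map_map]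
    simp only [Function.comp_apply, Multiset.map_cons, Multiset.sum_cons, Multiset.sum_map_add,
      Multiset.map_const', Multiset.sum_replicate, Multiset.card_powersetCard, smul_eq_mul,
      Multiset.card_cons, Nat.add_sub_cancel]
    rcases m with _ | m
    · simp
      ring
    · rw [ih]
      rcases Multiset.empty_or_exists_mem t with rfl | ⟨y, hy⟩
      · simp
      · obtain ⟨n, hn⟩ : ∃ n, t.card = n + 1 :=
          ⟨t.card - 1, by have := Multiset.card_pos_iff_exists_mem.2 ⟨y, hy⟩; omega⟩
        rw [hn, Nat.add_sub_cancel, Nat.choose_succ_succ]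
        ring

/-- Division-free form of: a uniform sample of size `m` carries on average the fraction `m / t.card`
of any additive quantity. -/
theorem card_mul_sum_powersetCard (φ : ℕ → ℕ) (t : Multiset ℕ) (m : ℕ) :
    t.card * ((Multiset.powersetCard m t).map fun a => (a.map φ).sum).sum =
      m * t.card.choose m * (t.map φ).sum := by
  rcases m with _ | m
  · simp
  · rw [sum_powersetCard_succ]
    rcases Multiset.empty_or_exists_mem t with rfl | ⟨y, hy⟩
    · simp
    · obtain ⟨n, hn⟩ : ∃ n, t.card = n + 1 :=
        ⟨t.card - 1, by have := Multiset.card_pos_iff_exists_mem.2 ⟨y, hy⟩; omega⟩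
      rw [hn, Nat.add_sub_cancel, ← mul_assoc, Nat.add_one_mul_choose_eq]
      ring

/-- Sum of `f` over the states to which the possible samples of an arriving job lead. -/
noncomputable def arrivalSum (k m : ℕ) (f : Multiset ℕ → ℕ) (t : Multiset ℕ) : ℕ :=
  ((Multiset.powersetCard m t).map fun a => f (t - a + fill k a)).sum

/-- Sum of `f` over the states to which the possible task completions lead. -/
noncomputable def departureSum (f : Multiset ℕ → ℕ) (t : Multiset ℕ) : ℕ :=
  ((t.filter (0 < ·)).map fun x => f ((x - 1) ::ₘ t.erase x)).sum

theorem card_after_arrival {k : ℕ} {t a : Multiset ℕ} (h : a ≤ t) :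
    (t - a + fill k a).card = t.card := by
  rw [Multiset.card_add, card_fill, Multiset.card_sub h]
  exact Nat.sub_add_cancel (Multiset.card_le_card h)

theorem card_after_departure {x : ℕ} {t : Multiset ℕ} (h : x ∈ t) :
    ((x - 1) ::ₘ t.erase x).card = t.card := by
  rw [Multiset.card_cons, Multiset.card_erase_add_one h]

theorem sum_map_after_arrival (φ : ℕ → ℕ) {k : ℕ} {t a : Multiset ℕ} (h : a ≤ t) :
    ((t - a + fill k a).map φ).sum + (a.map φ).sum = (t.map φ).sum + ((fill k a).map φ).sum := by
  conv_rhs => rw [← tsub_add_cancel_of_le h]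
  simp only [Multiset.map_add, Multiset.sum_add]
  ring

theorem sum_map_after_departure (φ : ℕ → ℕ) {x : ℕ} {t : Multiset ℕ} (h : x ∈ t) :
    (((x - 1) ::ₘ t.erase x).map φ).sum + φ x = (t.map φ).sum + φ (x - 1) := by
  conv_rhs => rw [← Multiset.cons_erase h]
  simp only [Multiset.map_cons, Multiset.sum_cons]
  ring

theorem sum_map_filter_const (t : Multiset ℕ) (c : ℕ) :
    ((t.filter (0 < ·)).map fun _ => c).sum = t.countP (0 < ·) * c := by
  rw [Multiset.map_const', Multiset.sum_replicate, smul_eq_mul, Multiset.countP_eq_card_filter]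

/-! Squares of the queue lengths. -/

theorem arrivalSum_sq_le {k m : ℕ} (hm : 0 < m) {t : Multiset ℕ} :
    t.card * arrivalSum k m (fun t => (t.map (· ^ 2)).sum) t ≤
      t.card.choose m * (t.card * ((t.map (· ^ 2)).sum + (2 * k ^ 2 + k)) + 2 * k * t.sum) := by
  have h1 : m * arrivalSum k m (fun t => (t.map (· ^ 2)).sum) t ≤
      ((Multiset.powersetCard m t).map fun a =>
        m * ((t.map (· ^ 2)).sum + (2 * k ^ 2 + k)) + 2 * k * (a.map id).sum).sum := by
    rw [arrivalSum, ← Multiset.sum_map_mul_left]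
    refine Multiset.sum_map_le_sum_map _ _ fun a ha => ?_
    obtain ⟨hat, ham⟩ := Multiset.mem_powersetCard.1 ha
    have h2 := sum_map_after_arrival (· ^ 2) (k := k) hat
    have h3 := sum_sq_fill_le k (a := a) (by omega)
    rw [ham] at h3
    rw [Multiset.map_id]
    nlinarith
  rw [Multiset.sum_map_add, Multiset.map_const', Multiset.sum_replicate, smul_eq_mul,
    Multiset.card_powersetCard, Multiset.sum_map_mul_left] at h1
  have h4 := card_mul_sum_powersetCard id t m
  rw [Multiset.map_id] at h4
  refine Nat.le_of_mul_le_mul_left ?_ hm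
  calc _ = t.card * (m * arrivalSum k m (fun t => (t.map (· ^ 2)).sum) t) := by ring
    _ ≤ t.card * _ := Nat.mul_le_mul_left _ h1
    _ = t.card * (t.card.choose m * (m * ((t.map (· ^ 2)).sum + (2 * k ^ 2 + k)))) +
        2 * k * (t.card *
          ((Multiset.powersetCard m t).map fun a => (a.map id).sum).sum) := by ring
    _ = _ := by rw [h4]; ring

theorem departureSum_sq (t : Multiset ℕ) :
    departureSum (fun t => (t.map (· ^ 2)).sum) t + 2 * t.sum =
      t.countP (0 < ·) * ((t.map (· ^ 2)).sum + 1) := by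
  have h1 : ((t.filter (0 < ·)).map fun x => 2 * x).sum = 2 * t.sum := by
    rw [sum_map_filter_eq (by intro x hx; omega), Multiset.sum_map_mul_left, Multiset.map_id']
  rw [departureSum, ← h1, ← Multiset.sum_map_add, ← sum_map_filter_const]
  refine congrArg _ (Multiset.map_congr rfl fun x hx => ?_)
  obtain ⟨hxt, hx0⟩ := Multiset.mem_filter.1 hx
  have h2 := sum_map_after_departure (· ^ 2) hxt
  obtain ⟨y, rfl⟩ : ∃ y, x = y + 1 := ⟨x - 1, by omega⟩
  simp only [Nat.add_sub_cancel] at h2 ⊢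
  nlinarith

/-! Truncations of the total number of tasks. -/

/-- Truncation at `n` keeps the test function bounded, so no moment of the stationary law is needed.
Below the cut a job adds all `k` tasks; above it nothing is lost. -/
theorem arrivalSum_min_ge {k m : ℕ} (hm : 0 < m) (n : ℕ) (t : Multiset ℕ) :
    t.card.choose m * (min t.sum n + if t.sum + k ≤ n then k else 0) ≤
      arrivalSum k m (fun t => min t.sum n) t := by
  rw [arrivalSum, ← Multiset.card_powersetCard, ← smul_eq_mul,
    ← Multiset.card_map (fun a => min (t - a + fill k a).sum n)]
  refine Multiset.card_nsmul_le_sum fun y hy => ?_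
  obtain ⟨a, ha, rfl⟩ := Multiset.mem_map.1 hy
  obtain ⟨hat, ham⟩ := Multiset.mem_powersetCard.1 ha
  have h2 := sum_map_after_arrival id (k := k) hat
  simp only [Multiset.map_id, sum_fill k (a := a) (by omega)] at h2
  split_ifs <;> omega

theorem departureSum_min_ge (n : ℕ) (t : Multiset ℕ) :
    t.countP (0 < ·) * min t.sum n ≤
      departureSum (fun t => min t.sum n) t + t.countP (0 < ·) := by
  have h1 := sum_map_filter_const t 1
  rw [mul_one] at h1
  rw [← sum_map_filter_const, departureSum]
  conv_rhs => rw [← h1]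
  rw [← Multiset.sum_map_add]
  refine Multiset.sum_map_le_sum_map _ _ fun x hx => ?_
  obtain ⟨hxt, hx0⟩ := Multiset.mem_filter.1 hx
  have h2 := sum_map_after_departure id hxt
  rw [Multiset.map_id, Multiset.map_id, id_eq, id_eq] at h2
  omega

/-! Numbers of short queues. -/

theorem countP_eq_sum_map (p : ℕ → Prop) [DecidablePred p] (t : Multiset ℕ) :
    t.countP p = (t.map fun x => if p x then 1 else 0).sum := by
  induction t using Multiset.induction_on with
  | empty => simp
  | cons a t ih => rw [Multiset.countP_cons, ih, Multiset.map_cons, Multiset.sum_cons, add_comm]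

/-- Only sampled queues change, so a job destroys at most the short queues in its sample. -/
theorem arrivalSum_countP_lt_ge (k m i : ℕ) (t : Multiset ℕ) :
    t.card * (t.card.choose m * t.countP (· < i)) ≤
      t.card * arrivalSum k m (fun t => t.countP (· < i)) t +
        m * t.card.choose m * t.countP (· < i) := by
  simp only [countP_eq_sum_map (· < i)]
  rw [← card_mul_sum_powersetCard, ← mul_add]
  refine Nat.mul_le_mul_left _ ?_
  rw [arrivalSum, ← Multiset.sum_map_add, ← Multiset.card_powersetCard, ← smul_eq_mul,
    ← Multiset.sum_replicate, ← Multiset.map_const']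
  refine Multiset.sum_map_le_sum_map _ _ fun a ha => ?_
  have h2 := sum_map_after_arrival (fun x => if x < i then 1 else 0) (k := k)
    (Multiset.mem_powersetCard.1 ha).1
  omega

/-- A completion creates a short queue exactly when it occurs at a queue of length `i`; for `i = 0`
there would be no such completion. -/
theorem departureSum_countP_lt {i : ℕ} (hi : 0 < i) (t : Multiset ℕ) :
    departureSum (fun t => t.countP (· < i)) t =
      t.countP (0 < ·) * t.countP (· < i) + t.count i := by
  have h1 : ((t.filter (0 < ·)).map fun x => if i = x then 1 else 0).sum = t.count i := by
    rw [sum_map_filter_eq (by intro x hx; rw [if_neg]; omega), Multiset.count, countP_eq_sum_map]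
  rw [departureSum, ← h1, ← sum_map_filter_const, ← Multiset.sum_map_add]
  refine congrArg _ (Multiset.map_congr rfl fun x hx => ?_)
  obtain ⟨hxt, hx0⟩ := Multiset.mem_filter.1 hx
  have h2 := sum_map_after_departure (fun x => if x < i then 1 else 0) hxt
  simp only [countP_eq_sum_map (· < i)]
  split_ifs at * <;> omega

theorem countP_lt_succ (i : ℕ) (t : Multiset ℕ) :
    t.countP (· < i + 1) = t.countP (· < i) + t.count i := by
  rw [Multiset.count, countP_eq_sum_map, countP_eq_sum_map, countP_eq_sum_map,
    ← Multiset.sum_map_add]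
  refine congrArg _ (Multiset.map_congr rfl fun x _ => ?_)
  split_ifs <;> omega

theorem countP_not_add (p : ℕ → Prop) [DecidablePred p] (t : Multiset ℕ) :
    t.countP (fun x => ¬ p x) + t.countP p = t.card := by
  rw [add_comm, ← Multiset.card_eq_countP_add_countP]

end BatchFilling

/-! ### The generator on test functions, and stationary means. -/

namespace BatchFilling

open scoped ENNReal
open MarkovRate

/-- Each outcome `g a` is exactly one state, so summing over target states amounts to summing over
transitions. -/
theorem tsum_countP_mul {N : ℕ} {A : Type*} (M : Multiset A) (g : A → Multiset ℕ)
    (f : Multiset ℕ → ℝ≥0∞) (hg : ∀ a ∈ M, (g a).card = N) :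
    ∑' s : State N, (M.countP (fun a => g a = (s : Multiset ℕ)) : ℝ≥0∞) * f s =
      (M.map fun a => f (g a)).sum := by
  induction M using Multiset.induction_on with
  | empty => simp
  | cons a M ih =>
    have ha : (g a).card = N := hg a (Multiset.mem_cons_self a M)
    simp only [Multiset.countP_cons, Nat.cast_add, add_mul, Multiset.map_cons, Multiset.sum_cons]
    rw [ENNReal.tsum_add, ih (fun b hb => hg b (Multiset.mem_cons_of_mem hb)), add_comm]
    congr 1
    rw [tsum_eq_single (Sym.mk (g a) ha)]
    · simp
    · intro s hs
      have : ¬ g a = (s : Multiset ℕ) := fun h => hs (Sym.ext h.symm)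
      simp [this]

/-- The rates of the system, as extended nonnegative reals. -/
noncomputable def erate {N : ℕ} (lam : ℝ) (k m : ℕ) (s s' : State N) : ℝ≥0∞ :=
  ENNReal.ofReal (rate lam k m s s')

/-- The rate of job arrivals. -/
noncomputable def jobRate (N : ℕ) (lam : ℝ) (k : ℕ) : ℝ≥0∞ := ENNReal.ofReal (N * lam / k)

theorem jobRate_mul {N k : ℕ} (lam : ℝ) (hk : 0 < k) :
    jobRate N lam k * k = N * ENNReal.ofReal lam := by
  rw [jobRate, ← ENNReal.ofReal_natCast k, ← ENNReal.ofReal_natCast N,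
    ← ENNReal.ofReal_mul' (by positivity), ← ENNReal.ofReal_mul (by positivity),
    div_mul_cancel₀ _ (by positivity)]

theorem isStationary_iff {N : ℕ} {lam : ℝ} {k m : ℕ} {π : PMF (State N)} :
    IsStationary lam k m π ↔ Balanced (erate lam k m) π := Iff.rfl

theorem erate_eq {N : ℕ} {lam : ℝ} (hlam : 0 ≤ lam) {k m : ℕ} (hm : m ≤ N) (s s' : State N) :
    erate lam k m s s' =
      jobRate N lam k / (N.choose m : ℝ≥0∞) *
        ((Multiset.powersetCard m (s : Multiset ℕ)).countP
          (fun a => (s : Multiset ℕ) - a + fill k a = (s' : Multiset ℕ)) : ℝ≥0∞) +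
      (((s : Multiset ℕ).filter (0 < ·)).countP
        (fun x => (x - 1) ::ₘ (s : Multiset ℕ).erase x = (s' : Multiset ℕ)) : ℝ≥0∞) := by
  have hC : (0 : ℝ) < N.choose m := by exact_mod_cast Nat.choose_pos hm
  rw [erate, rate, arrivalRate, departureRate,
    ENNReal.ofReal_add (by positivity) (by positivity), ENNReal.ofReal_natCast,
    ENNReal.ofReal_mul (by positivity), ENNReal.ofReal_div_of_pos hC, ENNReal.ofReal_natCast,
    ENNReal.ofReal_natCast, Multiset.countP_filter]
  congr 1
  · rw [jobRate, div_eq_mul_inv _ (N.choose m : ℝ≥0∞), div_eq_mul_inv _ (N.choose m : ℝ≥0∞)]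
    ring
  · simp only [and_comm]

theorem tsum_erate_mul {N : ℕ} {lam : ℝ} (hlam : 0 ≤ lam) {k m : ℕ} (hm : m ≤ N)
    (f : Multiset ℕ → ℕ) (s : State N) :
    ∑' s' : State N, erate lam k m s s' * (f s' : ℝ≥0∞) =
      jobRate N lam k / (N.choose m : ℝ≥0∞) * (arrivalSum k m f s : ℝ≥0∞) +
        (departureSum f s : ℝ≥0∞) := by
  simp only [erate_eq hlam hm, add_mul, mul_assoc]
  rw [ENNReal.tsum_add, ENNReal.tsum_mul_left,
    tsum_countP_mul _ (fun a => (s : Multiset ℕ) - a + fill k a) (fun t => (f t : ℝ≥0∞)),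
    tsum_countP_mul _ (fun x => (x - 1) ::ₘ (s : Multiset ℕ).erase x) (fun t => (f t : ℝ≥0∞)),
    arrivalSum, departureSum, Nat.cast_multiset_sum, Nat.cast_multiset_sum, Multiset.map_map,
    Multiset.map_map]
  · rfl
  · intro x hx
    rw [card_after_departure (Multiset.mem_of_mem_filter hx)]
    exact s.2
  · intro a ha
    rw [card_after_arrival (Multiset.mem_powersetCard.1 ha).1]
    exact s.2

theorem jobRate_div_mul {N m : ℕ} (lam : ℝ) (k : ℕ) (hm : m ≤ N) :
    jobRate N lam k / (N.choose m : ℝ≥0∞) * (N.choose m : ℝ≥0∞) = jobRate N lam k :=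
  ENNReal.div_mul_cancel (by exact_mod_cast (Nat.choose_pos hm).ne') (ENNReal.natCast_ne_top _)

/-- The number of busy servers. -/
def busy (t : Multiset ℕ) : ℕ := t.countP (0 < ·)

theorem busy_le {N : ℕ} (s : State N) : busy s ≤ N :=
  (Multiset.countP_le_card _ _).trans s.2.le

theorem tsum_erate {N : ℕ} {lam : ℝ} (hlam : 0 ≤ lam) {k m : ℕ} (hm : m ≤ N) (s : State N) :
    ∑' s' : State N, erate lam k m s s' = jobRate N lam k + (busy s : ℝ≥0∞) := by
  have h1 := tsum_erate_mul (k := k) hlam hm (fun _ => 1) s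
  have h2 : (s : Multiset ℕ).card = N := s.2
  simp only [Nat.cast_one, mul_one, departureSum, arrivalSum, ← Multiset.countP_eq_card_filter,
    Multiset.map_const', Multiset.sum_replicate, Multiset.card_powersetCard, h2, smul_eq_mul,
    jobRate_div_mul lam k hm] at h1
  exact h1

theorem tsum_mul_generator_eq {N : ℕ} {lam : ℝ} (hlam : 0 ≤ lam) {k m : ℕ} (hm : m ≤ N)
    {π : PMF (State N)} (hπ : IsStationary lam k m π) (f : Multiset ℕ → ℕ) :
    ∑' s : State N, π s * (jobRate N lam k / (N.choose m : ℝ≥0∞) * (arrivalSum k m f s : ℝ≥0∞) +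
        (departureSum f s : ℝ≥0∞)) =
      ∑' s : State N, π s * ((jobRate N lam k + (busy s : ℝ≥0∞)) * (f s : ℝ≥0∞)) := by
  have h := Balanced.tsum_mul_eq (isStationary_iff.1 hπ) (fun s => (f s : ℝ≥0∞))
  simpa only [tsum_erate_mul hlam hm, tsum_erate hlam hm] using h

theorem jobRate_ne_top (N : ℕ) (lam : ℝ) (k : ℕ) : jobRate N lam k ≠ ∞ := ENNReal.ofReal_ne_top

/-- If the generator is pointwise at least `u - v` on a bounded test function, then the stationary
mean of `u` is at most that of `v`. -/
theorem tsum_mul_le_of_generator {N : ℕ} {lam : ℝ} (hlam : 0 ≤ lam) {k m : ℕ} (hm : m ≤ N)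
    {π : PMF (State N)} (hπ : IsStationary lam k m π) (f : Multiset ℕ → ℕ) (B : ℕ)
    (hf : ∀ s : State N, f s ≤ B) (u v : State N → ℝ≥0∞)
    (h : ∀ s : State N, (jobRate N lam k + (busy s : ℝ≥0∞)) * (f s : ℝ≥0∞) + u s ≤
      jobRate N lam k / (N.choose m : ℝ≥0∞) * (arrivalSum k m f s : ℝ≥0∞) +
        (departureSum f s : ℝ≥0∞) + v s) :
    ∑' s, π s * u s ≤ ∑' s, π s * v s := by
  -- Boundedness of `f` makes this mean finite, so that it can be cancelled.
  have h1 : ∑' s : State N, π s * ((jobRate N lam k + (busy s : ℝ≥0∞)) * (f s : ℝ≥0∞)) ≠ ∞ := by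
    refine ne_top_of_le_ne_top (b := (jobRate N lam k + N) * B) ?_ ?_
    · exact ENNReal.mul_ne_top (ENNReal.add_ne_top.2 ⟨jobRate_ne_top _ _ _,
        ENNReal.natCast_ne_top _⟩) (ENNReal.natCast_ne_top _)
    · calc _ ≤ ∑' s : State N, π s * ((jobRate N lam k + N) * B) := by
            gcongr with s
            · exact busy_le s
            · exact hf s
        _ = _ := by rw [ENNReal.tsum_mul_right, π.tsum_coe, one_mul]
  rw [← ENNReal.add_le_add_iff_left h1]
  conv_rhs => rw [← tsum_mul_generator_eq hlam hm hπ f]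
  rw [← ENNReal.tsum_add, ← ENNReal.tsum_add]
  refine ENNReal.tsum_le_tsum fun s => ?_
  rw [← mul_add, ← mul_add]
  exact mul_le_mul_right (h s) _

/-- The mean number of busy servers is at least the load. -/
theorem le_tsum_busy {N : ℕ} {lam : ℝ} (hlam : 0 ≤ lam) {k m : ℕ} (hk : 0 < k) (hm0 : 0 < m)
    (hm : m ≤ N) {π : PMF (State N)} (hπ : IsStationary lam k m π) :
    N * ENNReal.ofReal lam ≤ ∑' s, π s * (busy s : ℝ≥0∞) := by
  have key : ∀ n : ℕ, ∑' s : State N,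
      π s * (N * ENNReal.ofReal lam * if (s : Multiset ℕ).sum + k ≤ n then 1 else 0) ≤
        ∑' s, π s * (busy s : ℝ≥0∞) := by
    intro n
    refine tsum_mul_le_of_generator hlam hm hπ (fun t => min t.sum n) n
      (fun s => min_le_right _ _) _ _ fun s => ?_
    have h1 := arrivalSum_min_ge (k := k) hm0 n (s : Multiset ℕ)
    have h2 := departureSum_min_ge n (s : Multiset ℕ)
    rw [show (s : Multiset ℕ).card = N from s.2] at h1
    change busy s * min (s : Multiset ℕ).sum n ≤ _ + busy s at h2
    have h3 : jobRate N lam k * (((min (s : Multiset ℕ).sum n : ℕ) : ℝ≥0∞) +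
        if (s : Multiset ℕ).sum + k ≤ n then (k : ℝ≥0∞) else 0) ≤
        jobRate N lam k / (N.choose m : ℝ≥0∞) *
          (arrivalSum k m (fun t => min t.sum n) s : ℝ≥0∞) := by
      conv_lhs => rw [← jobRate_div_mul lam k hm, mul_assoc]
      refine mul_le_mul_right ?_ _
      exact_mod_cast h1
    have h4 : (busy s : ℝ≥0∞) * ((min (s : Multiset ℕ).sum n : ℕ) : ℝ≥0∞) ≤
        (departureSum (fun t => min t.sum n) s : ℝ≥0∞) + (busy s : ℝ≥0∞) := by exact_mod_cast h2
    have h5 : N * ENNReal.ofReal lam * (if (s : Multiset ℕ).sum + k ≤ n then 1 else 0) =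
        jobRate N lam k * if (s : Multiset ℕ).sum + k ≤ n then (k : ℝ≥0∞) else 0 := by
      rw [← jobRate_mul lam hk]
      split_ifs <;> simp
    rw [h5]
    calc _ = jobRate N lam k * (((min (s : Multiset ℕ).sum n : ℕ) : ℝ≥0∞) +
        if (s : Multiset ℕ).sum + k ≤ n then (k : ℝ≥0∞) else 0) +
          (busy s : ℝ≥0∞) * ((min (s : Multiset ℕ).sum n : ℕ) : ℝ≥0∞) := by ring
      _ ≤ _ := add_le_add h3 h4
      _ = _ := by ring
  -- A finite set of states lies below some truncation level, where the indicator in `key` is one.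
  have hfin : ∀ F : Finset (State N), ∑ s ∈ F, π s * (N * ENNReal.ofReal lam) ≤
      ∑' s, π s * (busy s : ℝ≥0∞) := by
    intro F
    refine le_trans ?_ (key (F.sup (fun s => (s : Multiset ℕ).sum) + k))
    refine le_trans (Finset.sum_le_sum fun s hs => ?_) (ENNReal.sum_le_tsum F)
    rw [if_pos, mul_one]
    exact Nat.add_le_add_right (Finset.le_sup (f := fun s : State N => (s : Multiset ℕ).sum) hs) k
  have := ENNReal.summable.tsum_le_of_sum_le hfin
  rwa [ENNReal.tsum_mul_right, π.tsum_coe, one_mul] at this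

/-- The number of servers with fewer than `i` tasks. -/
def short (i : ℕ) (t : Multiset ℕ) : ℕ := t.countP (· < i)

theorem tsum_short_one_le {N : ℕ} {lam : ℝ} (hlam : 0 ≤ lam) (hlam1 : lam ≤ 1) {k m : ℕ}
    (hk : 0 < k) (hm0 : 0 < m) (hm : m ≤ N) {π : PMF (State N)} (hπ : IsStationary lam k m π) :
    ∑' s, π s * (short 1 s : ℝ≥0∞) ≤ N * ENNReal.ofReal (1 - lam) := by
  have h1 : ∑' s, π s * (short 1 s : ℝ≥0∞) + ∑' s, π s * (busy s : ℝ≥0∞) = N := by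
    rw [← ENNReal.tsum_add]
    calc _ = ∑' s : State N, π s * (N : ℝ≥0∞) := by
          refine tsum_congr fun s => ?_
          rw [← mul_add, ← Nat.cast_add]
          have h2 := countP_not_add (0 < ·) (s : Multiset ℕ)
          rw [show (s : Multiset ℕ).card = N from s.2] at h2
          simp only [not_lt, Nat.le_zero] at h2
          simp only [short, busy, Nat.lt_one_iff, h2]
      _ = _ := by rw [ENNReal.tsum_mul_right, π.tsum_coe, one_mul]
  have h2 : (N : ℝ≥0∞) * ENNReal.ofReal lam ≠ ∞ :=
    ENNReal.mul_ne_top (ENNReal.natCast_ne_top _) ENNReal.ofReal_ne_top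
  rw [← ENNReal.add_le_add_iff_right h2, ← mul_add, ← ENNReal.ofReal_add (by linarith) hlam,
    sub_add_cancel, ENNReal.ofReal_one, mul_one]
  exact (add_le_add_right (le_tsum_busy hlam hk hm0 hm hπ) _).trans h1.le

/-- With test function `short i`, the gain `count i` balances a loss of at most `lam * m / k * short
i`; and `short (i + 1) = short i + count i`. -/
theorem tsum_short_succ_le {N : ℕ} {lam : ℝ} (hlam : 0 ≤ lam) {k m : ℕ} (hk : 0 < k)
    (hm0 : 0 < m) (hm : m ≤ N) {π : PMF (State N)} (hπ : IsStationary lam k m π) {i : ℕ}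
    (hi : 0 < i) :
    ∑' s, π s * (short (i + 1) s : ℝ≥0∞) ≤
      ENNReal.ofReal (1 + lam * m / k) * ∑' s, π s * (short i s : ℝ≥0∞) := by
  have hN0 : (N : ℝ≥0∞) ≠ 0 := by exact_mod_cast (by omega : N ≠ 0)
  have hD : (N : ℝ≥0∞) * ENNReal.ofReal (lam * m / k) = jobRate N lam k * m := by
    rw [jobRate, ← ENNReal.ofReal_natCast m, ← ENNReal.ofReal_natCast N,
      ← ENNReal.ofReal_mul' (by positivity), ← ENNReal.ofReal_mul (by positivity)]
    congr 1
    ring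
  have key : ∑' s : State N, π s * ((s : Multiset ℕ).count i : ℝ≥0∞) ≤
      ∑' s, π s * (ENNReal.ofReal (lam * m / k) * (short i s : ℝ≥0∞)) := by
    refine tsum_mul_le_of_generator hlam hm hπ (short i) N
      (fun s => (Multiset.countP_le_card _ _).trans s.2.le) _ _ fun s => ?_
    have h1 := arrivalSum_countP_lt_ge k m i (s : Multiset ℕ)
    have h2 : departureSum (short i) s = busy s * short i s + (s : Multiset ℕ).count i :=
      departureSum_countP_lt hi (s : Multiset ℕ)
    rw [show (s : Multiset ℕ).card = N from s.2] at h1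
    change N * (N.choose m * short i s) ≤
      N * arrivalSum k m (short i) s + m * N.choose m * short i s at h1
    have h3 : jobRate N lam k * (short i s : ℝ≥0∞) ≤
        jobRate N lam k / (N.choose m : ℝ≥0∞) * (arrivalSum k m (short i) s : ℝ≥0∞) +
          ENNReal.ofReal (lam * m / k) * (short i s : ℝ≥0∞) := by
      rw [← ENNReal.mul_le_mul_iff_right hN0 (ENNReal.natCast_ne_top N)]
      rw [mul_add, ← mul_assoc _ (ENNReal.ofReal _), hD]
      have hJ := jobRate_div_mul lam k hm
      generalize jobRate N lam k / (N.choose m : ℝ≥0∞) = c at *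
      rw [← hJ]
      calc _ = c * ((N * (N.choose m * short i s) : ℕ) : ℝ≥0∞) := by push_cast; ring
        _ ≤ c * ((N * arrivalSum k m (short i) s + m * N.choose m * short i s : ℕ) : ℝ≥0∞) := by
          refine mul_le_mul_right ?_ _
          exact_mod_cast h1
        _ = _ := by push_cast; ring
    rw [h2]
    push_cast
    calc _ = jobRate N lam k * (short i s : ℝ≥0∞) + ((busy s : ℝ≥0∞) * (short i s : ℝ≥0∞) +
          ((s : Multiset ℕ).count i : ℝ≥0∞)) := by ring
      _ ≤ _ := add_le_add_left h3 _
      _ = _ := by ring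
  rw [ENNReal.ofReal_add zero_le_one (by positivity), ENNReal.ofReal_one, add_mul, one_mul,
    ← ENNReal.tsum_mul_left]
  calc _ = ∑' s, π s * (short i s : ℝ≥0∞) +
        ∑' s : State N, π s * ((s : Multiset ℕ).count i : ℝ≥0∞) := by
        rw [← ENNReal.tsum_add]
        refine tsum_congr fun s => ?_
        rw [← mul_add, ← Nat.cast_add]
        congr 2
        exact countP_lt_succ i _
    _ ≤ _ := add_le_add_right (key.trans (le_of_eq (tsum_congr fun s => by ring))) _

theorem tsum_short_le {N : ℕ} {lam : ℝ} (hlam : 0 ≤ lam) (hlam1 : lam ≤ 1) {k m : ℕ}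
    (hk : 0 < k) (hm0 : 0 < m) (hm : m ≤ N) {π : PMF (State N)} (hπ : IsStationary lam k m π)
    (i : ℕ) :
    ∑' s, π s * (short (i + 1) s : ℝ≥0∞) ≤
      ENNReal.ofReal ((1 + lam * m / k) ^ i * (N * (1 - lam))) := by
  induction i with
  | zero =>
    rw [pow_zero, one_mul, ENNReal.ofReal_mul (by positivity), ENNReal.ofReal_natCast, zero_add]
    exact tsum_short_one_le hlam hlam1 hk hm0 hm hπ
  | succ i ih =>
    refine (tsum_short_succ_le hlam hk hm0 hm hπ i.succ_pos).trans ?_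
    rw [pow_succ', mul_assoc, ENNReal.ofReal_mul (p := 1 + lam * m / k) (by positivity)]
    exact mul_le_mul_right ih _

/-- The factor `d` from the Markov threshold `1 / (3 * d)` cancels the denominator of the geometric
sum. -/
theorem geom_sum_le (d : ℝ) (h : ℕ) :
    d * ∑ i ∈ Finset.range h, (1 + d) ^ i ≤ (1 + d) ^ h := by
  have := mul_geom_sum (1 + d) h
  rw [add_sub_cancel_left] at this
  linarith

theorem frac_eq {N : ℕ} (hN : 0 < N) (s : State N) (i : ℕ) :
    frac s i = 1 - (short i s : ℝ) / N := by
  have h2 := countP_not_add (· < i) (s : Multiset ℕ)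
  rw [show (s : Multiset ℕ).card = N from s.2] at h2
  simp only [not_lt] at h2
  have h3 : ((s : Multiset ℕ).countP (fun x => i ≤ x) : ℝ) + (short i s : ℝ) = N := by
    exact_mod_cast h2
  rw [frac, eq_sub_iff_add_eq, ← add_div, h3, div_self (by positivity)]

theorem sum_frac_eq {N : ℕ} (hN : 0 < N) (s : State N) (h : ℕ) :
    ∑ i ∈ Finset.Icc 1 h, frac s i =
      h - (∑ i ∈ Finset.range h, (short (i + 1) s : ℝ)) / N := by
  simp only [frac_eq hN]
  rw [Finset.sum_sub_distrib, ← Finset.sum_div, Finset.range_eq_Ico,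
    Finset.sum_Ico_add' (fun i => (short i s : ℝ)) 0 h 1]
  simp only [Finset.sum_const, Nat.card_Icc, Nat.add_sub_cancel, nsmul_eq_mul, mul_one, zero_add]
  rfl

/-- In the stationary distribution, most of the servers have `h` tasks, with high probability. -/
theorem one_le_toOuterMeasure_add {N : ℕ} {lam d : ℝ} (hlam : 0 ≤ lam) (hlam1 : lam ≤ 1) {k m : ℕ}
    (hk : 0 < k) (hm0 : 0 < m) (hm : m ≤ N) (hd : (m : ℝ) = k * d) (h : ℕ)
    {π : PMF (State N)} (hπ : IsStationary lam k m π) :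
    1 ≤ π.toOuterMeasure {s : State N |
      (h : ℝ) - 1 / (3 * d) ≤ ∑ i ∈ Finset.Icc 1 h, frac s i} +
        ENNReal.ofReal (3 * (1 - lam) * (1 + d) ^ h) := by
  have hN : 0 < N := by omega
  have hNR : (0 : ℝ) < N := by exact_mod_cast hN
  have hkR : (0 : ℝ) < k := by exact_mod_cast hk
  have hmR : (0 : ℝ) < m := by exact_mod_cast hm0
  have hd0 : 0 < d := by
    rw [hd] at hmR
    exact pos_of_mul_pos_right hmR hkR.le
  have hmk : lam * m / k ≤ d := by
    rw [hd, ← mul_assoc, mul_comm lam, mul_assoc, mul_div_cancel_left₀ _ hkR.ne']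
    nlinarith
  set S := {s : State N | (h : ℝ) - 1 / (3 * d) ≤ ∑ i ∈ Finset.Icc 1 h, frac s i} with hS
  rw [PMF.toOuterMeasure_apply]
  -- Markov's inequality pointwise: outside `S` the numbers of short queues add up to more than `N /
  -- (3 * d)`.
  have h1 : (1 : ℝ≥0∞) ≤ ∑' s, (S.indicator π s + ENNReal.ofReal (3 * d / N) *
      ∑ i ∈ Finset.range h, π s * (short (i + 1) s : ℝ≥0∞)) := by
    rw [← π.tsum_coe]
    refine ENNReal.tsum_le_tsum fun s => ?_
    by_cases hs : s ∈ S
    · rw [Set.indicator_of_mem hs]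
      exact le_self_add
    · rw [Set.indicator_of_notMem hs, zero_add, ← Finset.mul_sum, mul_left_comm]
      refine le_mul_of_one_le_right' ?_
      have h2 : ∑ i ∈ Finset.Icc 1 h, frac s i < (h : ℝ) - 1 / (3 * d) := not_le.1 hs
      rw [sum_frac_eq hN] at h2
      have h3 : 1 / (3 * d) ≤ (∑ i ∈ Finset.range h, (short (i + 1) s : ℝ)) / N := by linarith
      rw [div_le_div_iff₀ (by positivity) hNR] at h3
      have h4 : 1 ≤ 3 * d / N * ((∑ i ∈ Finset.range h, short (i + 1) s : ℕ) : ℝ) := by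
        rw [div_mul_eq_mul_div, le_div_iff₀ hNR]
        push_cast
        linarith
      have h5 := ENNReal.ofReal_le_ofReal h4
      rw [ENNReal.ofReal_one, ENNReal.ofReal_mul (by positivity), ENNReal.ofReal_natCast] at h5
      exact_mod_cast h5
  refine h1.trans ?_
  rw [ENNReal.tsum_add, ENNReal.tsum_mul_left]
  refine add_le_add_right ?_ _
  rw [Summable.tsum_finsetSum (fun _ _ => ENNReal.summable)]
  have h6 : ∀ i ∈ Finset.range h, ∑' s, π s * (short (i + 1) s : ℝ≥0∞) ≤
      ENNReal.ofReal ((1 + d) ^ i * (N * (1 - lam))) := by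
    intro i _
    refine (tsum_short_le hlam hlam1 hk hm0 hm hπ i).trans (ENNReal.ofReal_le_ofReal ?_)
    have : 0 ≤ 1 - lam := by linarith
    gcongr
  have h7 : 0 ≤ 1 - lam := by linarith
  calc _ ≤ ENNReal.ofReal (3 * d / N) *
        ∑ i ∈ Finset.range h, ENNReal.ofReal ((1 + d) ^ i * (N * (1 - lam))) :=
        mul_le_mul_right (Finset.sum_le_sum h6) _
    _ = ENNReal.ofReal (3 * d / N * ∑ i ∈ Finset.range h, (1 + d) ^ i * (N * (1 - lam))) := by
      rw [ENNReal.ofReal_mul (by positivity), ENNReal.ofReal_sum_of_nonneg]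
      intro i _
      positivity
    _ ≤ _ := by
      refine ENNReal.ofReal_le_ofReal ?_
      rw [← Finset.sum_mul]
      calc _ = 3 * (1 - lam) * (d * ∑ i ∈ Finset.range h, (1 + d) ^ i) := by
            field_simp
        _ ≤ _ := by
          refine mul_le_mul_of_nonneg_left (geom_sum_le d h) (by positivity)

/-! Existence and uniqueness of the stationary distribution. -/

theorem tsum_erate_le {N : ℕ} {lam : ℝ} (hlam : 0 ≤ lam) {k m : ℕ} (hm : m ≤ N) (s : State N) :
    ∑' s' : State N, erate lam k m s s' ≤ jobRate N lam k + N := by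
  rw [tsum_erate hlam hm]
  gcongr
  exact busy_le s

theorem finite_sum_le (N n : ℕ) : {s : State N | (s : Multiset ℕ).sum ≤ n}.Finite := by
  refine ((Finset.range (n + 1)).sym N).finite_toSet.subset fun s hs => ?_
  simp only [Finset.mem_coe, Finset.mem_sym_iff, Finset.mem_range]
  intro a ha
  have h1 : a ≤ (s : Multiset ℕ).sum := Multiset.single_le_sum (fun _ _ => Nat.zero_le _) a ha
  have h2 : (s : Multiset ℕ).sum ≤ n := hs
  omega

/-- A transition lowers the total by at most one; with `finite_sum_le` every state has finitely many
predecessors. -/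
theorem sum_le_of_erate_ne_zero {N : ℕ} {lam : ℝ} (hlam : 0 ≤ lam) {k m : ℕ} (hm0 : 0 < m)
    (hm : m ≤ N) {s s' : State N} (h : erate lam k m s s' ≠ 0) :
    (s : Multiset ℕ).sum ≤ (s' : Multiset ℕ).sum + 1 := by
  by_contra hlt
  apply h
  rw [erate_eq hlam hm, Multiset.countP_eq_zero.2, Multiset.countP_eq_zero.2]
  · simp
  · intro x hx heq
    obtain ⟨hxs, hx0⟩ := Multiset.mem_filter.1 hx
    have h2 := sum_map_after_departure id hxs
    rw [Multiset.map_id, Multiset.map_id, id_eq, id_eq, heq] at h2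
    omega
  · intro a ha heq
    obtain ⟨has, ham⟩ := Multiset.mem_powersetCard.1 ha
    have h2 := sum_map_after_arrival id (k := k) has
    rw [Multiset.map_id, Multiset.map_id, Multiset.map_id, Multiset.map_id, heq,
      sum_fill k (by omega)] at h2
    omega

theorem reachable_empty {N : ℕ} {lam : ℝ} (hlam : 0 ≤ lam) {k m : ℕ} (hm : m ≤ N) (s : State N) :
    Relation.ReflTransGen (fun s s' : State N => erate lam k m s s' ≠ 0) s
      (Sym.replicate N 0) := by
  induction hn : (s : Multiset ℕ).sum using Nat.strong_induction_on generalizing s with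
  | _ n ih =>
    by_cases h0 : ∀ x ∈ s, x = 0
    · rw [Sym.eq_replicate.2 h0]
    · push Not at h0
      obtain ⟨x, hxs, hx0⟩ := h0
      have hxs' : x ∈ (s : Multiset ℕ) := hxs
      let s' : State N := Sym.mk ((x - 1) ::ₘ (s : Multiset ℕ).erase x)
        ((card_after_departure hxs').trans s.2)
      have h2 := sum_map_after_departure id hxs'
      rw [Multiset.map_id, Multiset.map_id, id_eq, id_eq] at h2
      refine Relation.ReflTransGen.head ?_ (ih (s' : Multiset ℕ).sum ?_ s' rfl)
      · rw [erate_eq hlam hm]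
        refine fun h => ?_
        have h3 := (add_eq_zero.1 h).2
        rw [Nat.cast_eq_zero, Multiset.countP_eq_zero] at h3
        exact h3 x (Multiset.mem_filter.2 ⟨hxs', Nat.pos_of_ne_zero hx0⟩) rfl
      · change ((x - 1) ::ₘ (s : Multiset ℕ).erase x).sum < n
        omega

/-- The sum of the squares of the queue lengths. -/
def sumSq (t : Multiset ℕ) : ℕ := (t.map (· ^ 2)).sum

/-- At rate `N * lam / k` a job adds on average at most `2 * k / N` times the total plus a constant,
while completions remove twice the total up to a constant. The net drift is `-2 * (1 - lam)` times
the total, with subtractions moved across. -/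
theorem drift_sq {N : ℕ} {lam : ℝ} (hlam : 0 ≤ lam) (hlam1 : lam ≤ 1) {k m : ℕ} (hk : 0 < k)
    (hm0 : 0 < m) (hm : m ≤ N) (s : State N) :
    ∑' s' : State N, erate lam k m s s' * (sumSq s' : ℝ≥0∞) +
        2 * ENNReal.ofReal (1 - lam) * ((s : Multiset ℕ).sum : ℝ≥0∞) ≤
      (∑' s' : State N, erate lam k m s s') * (sumSq s : ℝ≥0∞) +
        (jobRate N lam k * ((2 * k ^ 2 + k : ℕ) : ℝ≥0∞) + N) := by
  rw [tsum_erate hlam hm, tsum_erate_mul hlam hm sumSq]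
  have h1 := arrivalSum_sq_le (k := k) hm0 (t := (s : Multiset ℕ))
  have h2 := departureSum_sq (s : Multiset ℕ)
  rw [show (s : Multiset ℕ).card = N from s.2] at h1
  change N * arrivalSum k m sumSq s ≤
    N.choose m * (N * (sumSq s + (2 * k ^ 2 + k)) + 2 * k * (s : Multiset ℕ).sum) at h1
  change departureSum sumSq s + _ = busy s * (sumSq s + 1) at h2
  have hb := busy_le s
  generalize arrivalSum k m sumSq s = a at *
  generalize departureSum sumSq s = b at *
  generalize sumSq s = V at *
  generalize (s : Multiset ℕ).sum = S at *
  generalize busy s = B at *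
  generalize 2 * k ^ 2 + k = K at *
  have hN0 : (N : ℝ≥0∞) ≠ 0 := by exact_mod_cast (by omega : N ≠ 0)
  have h3 : jobRate N lam k / (N.choose m : ℝ≥0∞) * a ≤
      jobRate N lam k * (V + K) + 2 * ENNReal.ofReal lam * S := by
    rw [← ENNReal.mul_le_mul_iff_right hN0 (ENNReal.natCast_ne_top N)]
    calc _ = jobRate N lam k / (N.choose m : ℝ≥0∞) * ((N * a : ℕ) : ℝ≥0∞) := by push_cast; ring
      _ ≤ jobRate N lam k / (N.choose m : ℝ≥0∞) *
          ((N.choose m * (N * (V + K) + 2 * k * S) : ℕ) : ℝ≥0∞) := by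
        refine mul_le_mul_right ?_ _
        exact_mod_cast h1
      _ = jobRate N lam k / (N.choose m : ℝ≥0∞) * (N.choose m : ℝ≥0∞) *
          (N * (V + K)) + 2 * (jobRate N lam k / (N.choose m : ℝ≥0∞) * (N.choose m : ℝ≥0∞) * k) *
            S := by push_cast; ring
      _ = _ := by rw [jobRate_div_mul lam k hm, jobRate_mul lam hk]; ring
  have h4 : (b : ℝ≥0∞) + 2 * S ≤ B * V + N := by
    exact_mod_cast (by nlinarith : b + 2 * S ≤ B * V + N)
  have h5 : ENNReal.ofReal lam + ENNReal.ofReal (1 - lam) = 1 := by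
    rw [← ENNReal.ofReal_add hlam (by linarith), add_sub_cancel, ENNReal.ofReal_one]
  have h6 : (2 : ℝ≥0∞) * S ≠ ∞ := by exact_mod_cast ENNReal.natCast_ne_top (2 * S)
  rw [← ENNReal.add_le_add_iff_right h6]
  calc _ = jobRate N lam k / (N.choose m : ℝ≥0∞) * a + (b + 2 * S) +
        2 * ENNReal.ofReal (1 - lam) * S := by ring
    _ ≤ (jobRate N lam k * (V + K) + 2 * ENNReal.ofReal lam * S) + (B * V + N) +
        2 * ENNReal.ofReal (1 - lam) * S := by gcongr
    _ = ((jobRate N lam k + B) * V + (jobRate N lam k * K + N)) +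
        2 * (ENNReal.ofReal lam + ENNReal.ofReal (1 - lam)) * S := by ring
    _ = _ := by rw [h5, mul_one]

theorem existsUnique_isStationary {N : ℕ} {lam : ℝ} (hlam : 0 ≤ lam) (hlam1 : lam < 1) {k m : ℕ}
    (hk : 0 < k) (hm0 : 0 < m) (hm : m ≤ N) :
    ∃! π : PMF (State N), IsStationary lam k m π := by
  have hL0 : jobRate N lam k + (N : ℝ≥0∞) ≠ 0 := by
    refine fun h => ?_
    have : N = 0 := by exact_mod_cast (add_eq_zero.1 h).2
    omega
  have hL : jobRate N lam k + (N : ℝ≥0∞) ≠ ∞ :=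
    ENNReal.add_ne_top.2 ⟨jobRate_ne_top _ _ _, ENNReal.natCast_ne_top _⟩
  have hq : ∀ s : State N, ∑' s', erate lam k m s s' ≤ _ := tsum_erate_le hlam hm
  have hgap : 2 * ENNReal.ofReal (1 - lam) ≠ 0 :=
    mul_ne_zero two_ne_zero (ENNReal.ofReal_pos.2 (by linarith)).ne'
  have hgap_top : 2 * ENNReal.ofReal (1 - lam) ≠ ∞ :=
    ENNReal.mul_ne_top ENNReal.ofNat_ne_top ENNReal.ofReal_ne_top
  obtain ⟨π, hπ⟩ := exists_balanced hL0 hL hq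
    (fun s' => (finite_sum_le N ((s' : Multiset ℕ).sum + 1)).subset fun s hs =>
      sum_le_of_erate_ne_zero hlam hm0 hm hs)
    (fun s => (sumSq s : ℝ≥0∞))
    (fun s => 2 * ENNReal.ofReal (1 - lam) * ((s : Multiset ℕ).sum : ℝ≥0∞))
    (jobRate N lam k * ((2 * k ^ 2 + k : ℕ) : ℝ≥0∞) + N)
    (ENNReal.add_ne_top.2 ⟨ENNReal.mul_ne_top (jobRate_ne_top _ _ _) (ENNReal.natCast_ne_top _),
      ENNReal.natCast_ne_top _⟩)
    (Sym.replicate N 0) (ENNReal.natCast_ne_top _)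
    (fun n => by
      obtain ⟨l, hl⟩ := ENNReal.exists_nat_gt
        (ENNReal.div_ne_top (ENNReal.natCast_ne_top n) hgap)
      refine (finite_sum_le N l).subset fun s hs => ?_
      have h1 : 2 * ENNReal.ofReal (1 - lam) * ((s : Multiset ℕ).sum : ℝ≥0∞) ≤ n := hs
      rw [mul_comm, ← ENNReal.le_div_iff_mul_le (Or.inl hgap) (Or.inl hgap_top)] at h1
      exact_mod_cast h1.trans hl.le)
    (drift_sq hlam hlam1.le hk hm0 hm)
  exact ⟨π, hπ, fun ρ hρ => balanced_unique hL0 hL hq (Sym.replicate N 0)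
    (reachable_empty hlam hm) hρ hπ⟩

end BatchFilling

/-! ### Asymptotics of the parameters. -/

namespace BatchFilling

open scoped ENNReal

theorem log_one_add_le {d : ℝ} (hd : 0 < d) : Real.log (1 + d) ≤ 1 + |Real.log d| := by
  rw [Real.log_le_iff_le_exp (by linarith), Real.exp_add]
  have h1 : d ≤ Real.exp |Real.log d| := by
    conv_lhs => rw [← Real.exp_log hd]
    exact Real.exp_le_exp.2 (le_abs_self _)
  have h2 : 1 ≤ Real.exp |Real.log d| := Real.one_le_exp (abs_nonneg _)
  have h3 : (2 : ℝ) ≤ Real.exp 1 := by have := Real.add_one_le_exp (1 : ℝ); linarith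
  nlinarith

/-- Both `log k` and `log k * |log d|` are eventually at most `δ * log N`, the former because `1 ≤
log k` and `(log k) ^ 2 ≤ δ * log N`. So `h * log (1 + d)`, at most `C * log k * (1 + |log d|)`, is
at most `2 * C * δ * log N`. -/
theorem eventually_probes_le_and_growth {α : ℝ} (hα0 : 0 < α) {k m h : ℕ → ℕ} {d : ℕ → ℝ}
    (hk_top : Tendsto k atTop atTop)
    (hk : (fun N : ℕ => Real.log (k N)) =o[atTop] fun N : ℕ => Real.sqrt (Real.log N))
    (hd_pos : ∀ᶠ N : ℕ in atTop, 0 < d N)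
    (hm : ∀ᶠ N : ℕ in atTop, (m N : ℝ) = k N * d N)
    (hd : (fun N : ℕ => Real.log (d N)) =o[atTop]
      fun N : ℕ => Real.log N / Real.log (k N))
    (hh : (fun N : ℕ => (h N : ℝ)) =O[atTop] fun N : ℕ => Real.log (k N)) :
    ∀ᶠ N : ℕ in atTop, m N ≤ N ∧ (1 + d N) ^ h N ≤ (N : ℝ) ^ (α / 2) := by
  obtain ⟨C, hC, hCh⟩ := hh.exists_pos
  -- The bound `1 / 2` serves `m ≤ N`, where `log m ≤ 2 * δ * log N`; the bound `α / (4 * C)` serves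
  -- the growth estimate.
  obtain ⟨δ, hδ0, hδ1, hδ2⟩ : ∃ δ : ℝ, 0 < δ ∧ δ ≤ 1 / 2 ∧ δ * (4 * C) ≤ α := by
    refine ⟨min (1 / 2) (α / (4 * C)), by positivity, min_le_left _ _, ?_⟩
    rw [← le_div_iff₀ (by positivity)]
    exact min_le_right _ _
  have hlogk : ∀ᶠ N : ℕ in atTop, 1 ≤ Real.log (k N) :=
    (Real.tendsto_log_atTop.comp (tendsto_natCast_atTop_atTop.comp hk_top)).eventually_ge_atTop 1
  filter_upwards [hlogk, hk.bound hδ0, hd.bound hδ0, hCh.bound, hd_pos, hm,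
    eventually_ge_atTop 1, hk_top.eventually_ge_atTop 1] with N ha h1 h2 h3 hdN hmN hN hkN
  have hNR : (1 : ℝ) ≤ N := by exact_mod_cast hN
  have hkR : (0 : ℝ) < k N := by exact_mod_cast hkN
  have hb : 0 ≤ Real.log N := Real.log_nonneg hNR
  simp only [Real.norm_eq_abs] at h1 h2 h3
  rw [abs_of_nonneg (Real.sqrt_nonneg _), abs_of_nonneg (by linarith)] at h1
  rw [abs_of_nonneg (a := Real.log N / Real.log (k N)) (div_nonneg hb (by linarith))] at h2
  rw [abs_of_nonneg (by positivity), abs_of_nonneg (by linarith)] at h3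
  generalize haa : Real.log (k N) = a at *
  generalize hbb : Real.log N = b at *
  have h4 : a ^ 2 ≤ δ * b := by
    have h5 : a ^ 2 ≤ (δ * Real.sqrt b) ^ 2 := pow_le_pow_left₀ (by linarith) h1 2
    rw [mul_pow, Real.sq_sqrt hb] at h5
    nlinarith [mul_nonneg hδ0.le hb]
  have h5 : a ≤ δ * b := by nlinarith
  have h6 : a * |Real.log (d N)| ≤ δ * b := by
    calc _ ≤ a * (δ * (b / a)) := mul_le_mul_of_nonneg_left h2 (by linarith)
      _ = δ * b := by field_simp
  constructor
  · have h7 : Real.log (m N) ≤ Real.log N := by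
      rw [hmN, Real.log_mul hkR.ne' hdN.ne', haa, hbb]
      nlinarith [le_abs_self (Real.log (d N)), abs_nonneg (Real.log (d N))]
    have h8 : (0 : ℝ) < m N := by rw [hmN]; positivity
    exact_mod_cast (Real.log_le_log_iff h8 (by linarith)).1 h7
  · have h7 := log_one_add_le hdN
    rw [← Real.log_le_log_iff (by positivity) (by positivity), Real.log_pow,
      Real.log_rpow (by linarith), hbb]
    calc (h N : ℝ) * Real.log (1 + d N) ≤ (C * a) * (1 + |Real.log (d N)|) := by
          refine mul_le_mul h3 h7 (Real.log_nonneg (by linarith)) (by positivity)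
      _ = C * (a + a * |Real.log (d N)|) := by ring
      _ ≤ C * (δ * b + δ * b) := by gcongr
      _ = δ * (4 * C) * (b / 2) := by ring
      _ ≤ α * (b / 2) := by gcongr
      _ = α / 2 * b := by ring

end BatchFilling

theorem theorem3 (α β : ℝ) (hα0 : 0 < α) (hα : α < 1 / 2) (hβ0 : 0 < β) (hβ : β ≤ 1)
    (k m h : ℕ → ℕ) (d : ℕ → ℝ)
    (hk_top : Tendsto k atTop atTop)
    (hk : (fun N : ℕ => Real.log (k N)) =o[atTop] fun N : ℕ => Real.sqrt (Real.log N))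
    (hd_pos : ∀ᶠ N : ℕ in atTop, 0 < d N)
    (hm : ∀ᶠ N : ℕ in atTop, (m N : ℝ) = k N * d N)
    (hd : (fun N : ℕ => Real.log (d N)) =o[atTop]
      fun N : ℕ => Real.log N / Real.log (k N))
    (hh : (fun N : ℕ => (h N : ℝ)) =O[atTop] fun N : ℕ => Real.log (k N)) :
    ∀ᶠ N : ℕ in atTop,
      (∃! π : PMF (BatchFilling.State N),
        BatchFilling.IsStationary (1 - β * (N : ℝ) ^ (-α)) (k N) (m N) π) ∧
      ∀ π : PMF (BatchFilling.State N),
        BatchFilling.IsStationary (1 - β * (N : ℝ) ^ (-α)) (k N) (m N) π →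
        ENNReal.ofReal (1 / (4 * Real.exp 1 ^ 2)) ≤
          π.toOuterMeasure {s : BatchFilling.State N |
            (h N : ℝ) - 1 / (3 * d N) ≤ ∑ i ∈ Finset.Icc 1 (h N), BatchFilling.frac s i} := by
  -- The threshold `1 / 6` makes the failure bound `3 * N ^ (-(α / 2))` at most `1 / 2`.
  have hsmall : ∀ᶠ N : ℕ in atTop, (N : ℝ) ^ (-(α / 2)) ≤ 1 / 6 :=
    ((tendsto_rpow_neg_atTop (half_pos hα0)).comp
      tendsto_natCast_atTop_atTop).eventually_le_const (by norm_num)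
  filter_upwards [BatchFilling.eventually_probes_le_and_growth hα0 hk_top hk hd_pos hm hd hh,
    hsmall, hd_pos, hm, eventually_ge_atTop 1, hk_top.eventually_ge_atTop 1]
    with N hgrowth h6 hdN hmN hN hkN
  obtain ⟨hmle, hpow⟩ := hgrowth
  have hNR : (1 : ℝ) ≤ N := by exact_mod_cast hN
  have hkR : (0 : ℝ) < k N := by exact_mod_cast hkN
  have hm0 : 0 < m N := by
    have : (0 : ℝ) < m N := by rw [hmN]; positivity
    exact_mod_cast this
  have hp0 : 0 < (N : ℝ) ^ (-α) := Real.rpow_pos_of_pos (by linarith) _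
  have hp1 : (N : ℝ) ^ (-α) ≤ 1 := Real.rpow_le_one_of_one_le_of_nonpos hNR (by linarith)
  have hlam0 : 0 ≤ 1 - β * (N : ℝ) ^ (-α) := by nlinarith
  have hlam1 : 1 - β * (N : ℝ) ^ (-α) < 1 := by nlinarith
  refine ⟨BatchFilling.existsUnique_isStationary hlam0 hlam1 hkN hm0 hmle, fun π hπ => ?_⟩
  have key := BatchFilling.one_le_toOuterMeasure_add hlam0 hlam1.le hkN hm0 hmle hmN (h N) hπ
  have hbad : 3 * (1 - (1 - β * (N : ℝ) ^ (-α))) * (1 + d N) ^ h N ≤ 1 / 2 := by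
    calc _ = 3 * (β * (N : ℝ) ^ (-α)) * (1 + d N) ^ h N := by ring
      _ ≤ 3 * (1 * (N : ℝ) ^ (-α)) * (N : ℝ) ^ (α / 2) := by gcongr
      _ = 3 * (N : ℝ) ^ (-(α / 2)) := by
        rw [one_mul, mul_assoc, ← Real.rpow_add (by linarith)]
        ring_nf
      _ ≤ 1 / 2 := by linarith
  -- The argument gives probability at least `1 / 2`, more than the constant claimed.
  have hexp : 1 / (4 * Real.exp 1 ^ 2) ≤ 1 / 2 := by
    have h1 : (1 : ℝ) ≤ Real.exp 1 := Real.one_le_exp zero_le_one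
    exact one_div_le_one_div_of_le two_pos (by nlinarith)
  refine (ENNReal.ofReal_le_ofReal hexp).trans ?_
  rw [← ENNReal.add_le_add_iff_right (ENNReal.ofReal_ne_top (r := 1 / 2)),
    ← ENNReal.ofReal_add (by norm_num) (by norm_num), add_halves, ENNReal.ofReal_one]
  exact key.trans (add_le_add_right (ENNReal.ofReal_le_ofReal hbad) _)
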